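/- Let $n\ge 0$ and let $\mathrm{Cvx}_0(\mathbb R^n)$ be the class of geometric convex functions, i.e. of convex functions $\phi:\mathbb R^n\to[0,+\infty]$ with $\phi(0)=0$ whose epigraph $\mathrm{epi}(\phi)=\{(x,t)\in\mathbb R^n\times\mathbb R:\phi(x)\le t\}$ is closed. For functions $\psi_m,\psi:\mathbb R^n\to[-\infty,+\infty]$, write $\psi_m\xrightarrow{\tau}\psi$ (epi-convergence) if $\limsup_m \mathrm{epi}(\psi_m)\subseteq \mathrm{epi}(\psi)\subseteq\liminf_m \mathrm{epi}(\psi_m)$. Here, for a sequence of sets $K_m$, $\limsup_m K_m$ is the set of all limits of convergent sequences $(x_j)$ with $x_j\in K_{m_j}$ for some $m_1<m_2<\cdots$, and $\liminf_m K_m$ is the set of all limits of convergent sequences $(x_m)$ with $x_m\in K_m$ for all but finitely many $m$. For $\phi\in\mathrm{Cvx}_0(\mathbb R^n)$ define the polarity transform $$\mathcal A\phi(y)=\begin{cases}0, & y=0,\\ \displaystyle\sup_{\{x:\,\phi(x)>0\}}\frac{\langle x,y\rangle-1}{\phi(x)}, & 0\ne y\in\{\phi=0\}^\circ,\\ +\infty,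 & y\notin\{\phi=0\}^\circ,\end{cases}$$ where $S^\circ=\{y:\langle x,y\rangle\le 1\ \text{for all } x\in S\}$ and $\frac{c}{+\infty}=0$ for $c\in\mathbb R$, and the gauge transform $$\mathcal J\phi(x)=\inf\left\{r>0:\ \phi\!\left(\tfrac{x}{r}\right)\le\tfrac1r\right\},\qquad \inf\emptyset=+\infty .$$ Let $(\phi_m)_{m}$ be a sequence in $\mathrm{Cvx}_0(\mathbb R^n)$ and let $\phi\in\mathrm{Cvx}_0(\mathbb R^n)$. Then $$\phi_m\xrightarrow{\tau}\phi\iff\mathcal A\phi_m\xrightarrow{\tau}\mathcal A\phi,\qquad\text{and}\qquad \phi_m\xrightarrow{\tau}\phi\iff\mathcal J\phi_m\xrightarrow{\tau}\mathcal J\phi .$$ -/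

import Mathlib

open Filter Topology

namespace GeomConvex

/-- The (outer) upper limit of a sequence of sets: all limits of points `x j ∈ K (m j)` taken along
some subsequence of indices. -/
def limsupSet {X : Type*} [TopologicalSpace X] (K : ℕ → Set X) : Set X :=
  {p | ∃ m : ℕ → ℕ, StrictMono m ∧ ∃ x : ℕ → X, (∀ j, x j ∈ K (m j)) ∧ Tendsto x atTop (𝓝 p)}

/-- The (inner) lower limit of a sequence of sets: all limits of points `x m ∈ K m` taken for all
but finitely many indices. -/
def liminfSet {X : Type*} [TopologicalSpace X] (K : ℕ → Set X) : Set X :=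
  {p | ∃ x : ℕ → X, (∀ᶠ m in atTop, x m ∈ K m) ∧ Tendsto x atTop (𝓝 p)}

/-- Convergence of a sequence of sets in the `τ`-topology (Painlevé–Kuratowski convergence). -/
def SetTauTendsto {X : Type*} [TopologicalSpace X] (K : ℕ → Set X) (L : Set X) : Prop :=
  limsupSet K ⊆ L ∧ L ⊆ liminfSet K

/-- The epigraph of an extended-real-valued function, a subset of `X × ℝ`. -/
def epi {X : Type*} (φ : X → EReal) : Set (X × ℝ) :=
  {p | φ p.1 ≤ (p.2 : EReal)}

/-- Convergence of functions in the `τ`-topology (epi-convergence). -/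
def TauTendsto {X : Type*} [TopologicalSpace X] (φs : ℕ → X → EReal) (φ : X → EReal) : Prop :=
  SetTauTendsto (fun m => epi (φs m)) (epi φ)

/-- Geometric convex functions on `ℝⁿ`: non-negative closed convex functions, possibly with the
value `+∞`, vanishing at the origin. Convexity and closedness are those of the epigraph. -/
structure IsGeometricConvex {n : ℕ} (φ : EuclideanSpace ℝ (Fin n) → EReal) : Prop where
  nonneg : ∀ x, 0 ≤ φ x
  map_zero : φ 0 = 0
  convex_epi : Convex ℝ (epi φ)
  isClosed_epi : IsClosed (epi φ)

/-- The (one-sided) polar set `S° = {y | ⟨x, y⟩ ≤ 1 for all x ∈ S}`. -/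
def polarSet {n : ℕ} (S : Set (EuclideanSpace ℝ (Fin n))) : Set (EuclideanSpace ℝ (Fin n)) :=
  {y | ∀ x ∈ S, inner ℝ x y ≤ 1}

open Classical in
/-- The polarity transform `𝒜 φ`. In the supremum, a point `x` with `φ x = +∞` contributes
the value `0`. -/
noncomputable def polarTransform {n : ℕ} (φ : EuclideanSpace ℝ (Fin n) → EReal)
    (y : EuclideanSpace ℝ (Fin n)) : EReal :=
  if y = 0 then 0
  else if y ∈ polarSet {x | φ x = 0} then
    ⨆ x ∈ {x | 0 < φ x}, ((inner ℝ x y - 1 : ℝ) : EReal) / φ x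
  else ⊤

/-- The gauge transform `(𝒥 φ)(x) = inf {r > 0 | φ (x / r) ≤ 1 / r}`, with `inf ∅ = +∞`. -/
noncomputable def gaugeTransform {n : ℕ} (φ : EuclideanSpace ℝ (Fin n) → EReal)
    (x : EuclideanSpace ℝ (Fin n)) : EReal :=
  sInf (Real.toEReal '' {r : ℝ | 0 < r ∧ φ (r⁻¹ • x) ≤ ((r⁻¹ : ℝ) : EReal)})

end GeomConvex

namespace GeomConvex

/-! ### Limits of sequences of sets -/

/-! Both transforms act geometrically on epigraphs. After reflecting the last coordinate, the
epigraph of `polarTransform φ` is the polar of the epigraph of `φ`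
(`IsGeometricConvex.preimage_epi_polarTransform`). Polarity of closed convex sets containing the
origin is continuous (`SetTauTendsto.innerPolar`), and the bipolar theorem makes it an involution,
which gives the converse. At positive heights the gauge transform applies the involution `(x, r) ↦
(x / r, 1 / r)` to the epigraph (`IsGeometricConvex.mem_epi_gaugeTransform`). Convergence is
transported there by continuity; height `0` is recovered by approximating from above
(`TauTendsto.of_inversion`). -/

theorem mem_liminfSet_of_forall_eventually {X : Type*} [PseudoMetricSpace X] {K : ℕ → Set X} {p : X}
    (h : ∀ ε > 0, ∀ᶠ m in atTop, ∃ x ∈ K m, dist x p < ε) : p ∈ liminfSet K := by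
  -- The sets need not be closed, so near-minimisers of the distance to `p` replace nearest points.
  have key : ∀ m, ∃ x : X, (K m).Nonempty →
      x ∈ K m ∧ dist p x < Metric.infDist p (K m) + 1 / ((m : ℝ) + 1) := by
    intro m
    by_cases hm : (K m).Nonempty
    · obtain ⟨x, hx, hd⟩ := (Metric.infDist_lt_iff hm).1
        (lt_add_of_pos_right (Metric.infDist p (K m)) (Nat.one_div_pos_of_nat (α := ℝ) (n := m)))
      exact ⟨x, fun _ => ⟨hx, hd⟩⟩
    · exact ⟨p, fun h' => absurd h' hm⟩
  choose x hx using key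
  have hne : ∀ᶠ m in atTop, (K m).Nonempty :=
    (h 1 one_pos).mono fun m ⟨y, hy, _⟩ => ⟨y, hy⟩
  refine ⟨x, hne.mono fun m hm => (hx m hm).1, Metric.tendsto_nhds.2 fun ε hε => ?_⟩
  have h1 := (tendsto_one_div_add_atTop_nhds_zero_nat (𝕜 := ℝ)).eventually
    (gt_mem_nhds (half_pos hε))
  filter_upwards [h (ε / 2) (half_pos hε), h1, hne] with m ⟨y, hy, hyd⟩ hm hn
  have h2 := (hx m hn).2
  have h3 := Metric.infDist_le_dist_of_mem (x := p) hy
  rw [dist_comm] at hyd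
  rw [dist_comm]
  linarith

theorem forall_eventually_of_mem_liminfSet {X : Type*} [PseudoMetricSpace X] {K : ℕ → Set X}
    {p : X} (h : p ∈ liminfSet K) {ε : ℝ} (hε : 0 < ε) :
    ∀ᶠ m in atTop, ∃ x ∈ K m, dist x p < ε := by
  obtain ⟨x, hx, hp⟩ := h
  filter_upwards [hx, Metric.tendsto_nhds.1 hp ε hε] with m h1 h2
  exact ⟨x m, h1, h2⟩

theorem isClosed_liminfSet {X : Type*} [PseudoMetricSpace X] (K : ℕ → Set X) :
    IsClosed (liminfSet K) := by
  refine isClosed_of_closure_subset fun p hp => mem_liminfSet_of_forall_eventually fun ε hε => ?_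
  obtain ⟨q, hq, hpq⟩ := Metric.mem_closure_iff.1 hp (ε / 2) (half_pos hε)
  filter_upwards [forall_eventually_of_mem_liminfSet hq (half_pos hε)] with m ⟨x, hx, hxq⟩
  refine ⟨x, hx, ?_⟩
  rw [dist_comm] at hpq
  linarith [dist_triangle x q p]

theorem SetTauTendsto.preimage {X Y : Type*} [TopologicalSpace X] [TopologicalSpace Y]
    (e : X ≃ₜ Y) {K : ℕ → Set Y} {L : Set Y} (h : SetTauTendsto K L) :
    SetTauTendsto (fun m => e ⁻¹' K m) (e ⁻¹' L) := by
  constructor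
  · rintro p ⟨m, hm, x, hx, hp⟩
    exact h.1 ⟨m, hm, fun j => e (x j), hx, (e.continuous.tendsto p).comp hp⟩
  · intro p hp
    obtain ⟨x, hx, hxp⟩ := h.2 hp
    refine ⟨fun m => e.symm (x m), hx.mono fun m hm => by simpa using hm, ?_⟩
    simpa [Function.comp_def] using (e.symm.continuous.tendsto (e p)).comp hxp

theorem setTauTendsto_preimage_iff {X Y : Type*} [TopologicalSpace X] [TopologicalSpace Y]
    (e : X ≃ₜ Y) {K : ℕ → Set Y} {L : Set Y} :
    SetTauTendsto (fun m => e ⁻¹' K m) (e ⁻¹' L) ↔ SetTauTendsto K L := by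
  refine ⟨fun h => ?_, SetTauTendsto.preimage e⟩
  simpa [← Set.preimage_comp] using h.preimage e.symm

/-! ### Polar sets in a real inner product space -/

section Polar

variable {F : Type*} [NormedAddCommGroup F] [InnerProductSpace ℝ F]

/-- The one-sided polar of a set in a real inner product space. -/
def innerPolar (S : Set F) : Set F :=
  {y | ∀ x ∈ S, inner ℝ x y ≤ 1}

theorem zero_mem_innerPolar (S : Set F) : (0 : F) ∈ innerPolar S := fun x _ => by simp

theorem convex_innerPolar (S : Set F) : Convex ℝ (innerPolar S) := by
  intro y hy z hz a b ha hb hab x hx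
  rw [inner_add_right, real_inner_smul_right, real_inner_smul_right]
  nlinarith [hy x hx, hz x hx]

theorem isClosed_innerPolar (S : Set F) : IsClosed (innerPolar S) := by
  have : innerPolar S = ⋂ x ∈ S, {y | inner ℝ x y ≤ 1} := by ext; simp [innerPolar]
  rw [this]
  exact isClosed_biInter fun x _ => isClosed_le (by fun_prop) continuous_const

/-- A quantitative separation of a point `z` from a closed convex set containing `0` by a bounded
element of the polar. -/
theorem exists_mem_innerPolar_of_forall_le_norm [CompleteSpace F] {K : Set F} (hc : Convex ℝ K)
    (hcl : IsClosed K) (h0 : (0 : F) ∈ K) {z : F} {ε : ℝ} (hε : 0 < ε)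
    (hz : ∀ k ∈ K, ε ≤ ‖z - k‖) :
    ∃ w ∈ innerPolar K, ‖w‖ ≤ 2 / ε ∧ 1 + ε / (2 * ‖z‖) ≤ inner ℝ w z := by
  obtain ⟨p, hp, hpm⟩ := exists_norm_eq_iInf_of_complete_convex ⟨0, h0⟩ hcl.isComplete hc z
  have hproj := (norm_eq_iInf_iff_real_inner_le_zero hc hp).1 hpm
  set u := z - p with hu
  set d := ‖u‖ with hd
  have hεd : ε ≤ d := hz p hp
  have hdpos : 0 < d := hε.trans_le hεd
  have hz0 : 0 < ‖z‖ := hε.trans_le (by simpa using hz 0 h0)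
  set h : ℝ := inner ℝ u p with hh
  have hh0 : 0 ≤ h := by simpa using hproj 0 h0
  have huz : inner ℝ u z = h + d ^ 2 := by
    have : z = p + u := by rw [hu]; abel
    rw [this, inner_add_right, real_inner_self_eq_norm_sq]
  have hle : h + d ^ 2 ≤ d * ‖z‖ := huz ▸ real_inner_le_norm u z
  have hcpos : 0 < h + d ^ 2 / 2 := by positivity
  -- Pairing with `u` is at most `h` on `K` and equals `h + d ^ 2` at `z`. Normalising by the
  -- midpoint keeps the divisor positive even if `h = 0`, and bounds the norm by `2 / d`.
  refine ⟨(h + d ^ 2 / 2)⁻¹ • u, fun k hk => ?_, ?_, ?_⟩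
  · have hk' := hproj k hk
    rw [inner_sub_right] at hk'
    rw [real_inner_smul_right, real_inner_comm, inv_mul_le_iff₀ hcpos]
    nlinarith [sq_nonneg d]
  · rw [norm_smul, norm_inv, Real.norm_of_nonneg hcpos.le, inv_mul_le_iff₀ hcpos, mul_div_assoc',
      le_div_iff₀ hε]
    nlinarith
  · rw [real_inner_smul_left, huz, ← div_eq_inv_mul, le_div_iff₀ hcpos]
    have h1 : ε / (2 * ‖z‖) * (h + d ^ 2 / 2) ≤ d ^ 2 / 2 := by
      rw [div_mul_eq_mul_div, div_le_iff₀ (by positivity)]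
      calc ε * (h + d ^ 2 / 2) ≤ d * (d * ‖z‖) :=
            mul_le_mul hεd (by nlinarith [sq_nonneg d]) hcpos.le hdpos.le
        _ = d ^ 2 / 2 * (2 * ‖z‖) := by ring
    linarith

/-- The bipolar theorem. -/
theorem innerPolar_innerPolar [CompleteSpace F] {K : Set F} (hc : Convex ℝ K)
    (hcl : IsClosed K) (h0 : (0 : F) ∈ K) : innerPolar (innerPolar K) = K := by
  refine Set.Subset.antisymm (fun z hz => ?_) fun x hx y hy => ?_
  · by_contra hzK
    obtain ⟨ε, hε, hball⟩ := Metric.isOpen_iff.1 hcl.isOpen_compl z hzK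
    obtain ⟨w, hw, -, hwz⟩ := exists_mem_innerPolar_of_forall_le_norm hc hcl h0 hε (z := z)
      fun k hk => by
        by_contra! hlt
        exact hball (by rwa [Metric.mem_ball, dist_comm, dist_eq_norm]) hk
    have hz0 : 0 < ‖z‖ := norm_pos_iff.2 fun h => hzK (h ▸ h0)
    have : 0 < ε / (2 * ‖z‖) := by positivity
    linarith [hz w hw]
  · rw [real_inner_comm]
    exact hy x hx

/-- Polarity is continuous for Painlevé–Kuratowski convergence of closed convex sets
containing the origin. -/
theorem SetTauTendsto.innerPolar [FiniteDimensional ℝ F] {K : ℕ → Set F} {L : Set F}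
    (hc : ∀ m, Convex ℝ (K m)) (hcl : ∀ m, IsClosed (K m)) (h0 : ∀ m, (0 : F) ∈ K m)
    (h : SetTauTendsto K L) :
    SetTauTendsto (fun m => GeomConvex.innerPolar (K m)) (GeomConvex.innerPolar L) := by
  have : CompleteSpace F := FiniteDimensional.complete ℝ F
  constructor
  · rintro y ⟨m, hm, ys, hys, hy⟩ x hx
    obtain ⟨xs, hxs, hxl⟩ := h.2 hx
    have h1 := (hxl.comp hm.tendsto_atTop).inner (𝕜 := ℝ) hy
    refine le_of_tendsto h1 ?_
    filter_upwards [hm.tendsto_atTop.eventually hxs] with j hj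
    exact hys j _ hj
  · refine fun y hy => mem_liminfSet_of_forall_eventually fun ε hε => ?_
    by_contra hcon
    obtain ⟨m, hm, hfar⟩ := extraction_of_frequently_atTop (not_eventually.1 hcon)
    push Not at hfar
    -- Separating `y` from the polars gives, by bipolarity, points of the sets themselves. The
    -- uniform norm bound gives a limit point in `L`, and the uniform excess over `1` survives to
    -- contradict `y ∈ innerPolar L`.
    have key : ∀ j, ∃ w ∈ K (m j), ‖w‖ ≤ 2 / ε ∧ 1 + ε / (2 * ‖y‖) ≤ inner ℝ w y := by
      intro j
      have := exists_mem_innerPolar_of_forall_le_norm (convex_innerPolar (K (m j)))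
        (isClosed_innerPolar _) (zero_mem_innerPolar _) hε (z := y)
        fun k hk => by rw [← dist_eq_norm, dist_comm]; exact hfar j k hk
      rwa [innerPolar_innerPolar (hc _) (hcl _) (h0 _)] at this
    choose w hwK hwn hwy using key
    obtain ⟨w₀, -, σ, hσ, hlim⟩ := (isCompact_closedBall (0 : F) (2 / ε)).tendsto_subseq
      (x := w) fun j => by simpa using hwn j
    have hw₀ : w₀ ∈ L := h.1 ⟨m ∘ σ, hm.comp hσ, w ∘ σ, fun j => hwK _, hlim⟩
    have hle : 1 + ε / (2 * ‖y‖) ≤ inner ℝ w₀ y :=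
      ge_of_tendsto' (hlim.inner (𝕜 := ℝ) tendsto_const_nhds) fun j => hwy _
    have hy0 : 0 < ‖y‖ := by
      have := hfar 0 0 (zero_mem_innerPolar _)
      rw [dist_zero_left] at this
      exact hε.trans_le this
    have : 0 < ε / (2 * ‖y‖) := by positivity
    linarith [hy w₀ hw₀]

theorem setTauTendsto_innerPolar_iff [FiniteDimensional ℝ F] {K : ℕ → Set F} {L : Set F}
    (hc : ∀ m, Convex ℝ (K m)) (hcl : ∀ m, IsClosed (K m)) (h0 : ∀ m, (0 : F) ∈ K m)
    (hcL : Convex ℝ L) (hclL : IsClosed L) (h0L : (0 : F) ∈ L) :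
    SetTauTendsto (fun m => innerPolar (K m)) (innerPolar L) ↔ SetTauTendsto K L := by
  have : CompleteSpace F := FiniteDimensional.complete ℝ F
  refine ⟨fun h => ?_, SetTauTendsto.innerPolar hc hcl h0⟩
  have h' := h.innerPolar (fun m => convex_innerPolar _) (fun m => isClosed_innerPolar _)
    fun m => zero_mem_innerPolar _
  rw [innerPolar_innerPolar hcL hclL h0L] at h'
  simpa only [innerPolar_innerPolar (hc _) (hcl _) (h0 _)] using h'

end Polar

/-! ### The epigraph of the polarity transform -/

theorem mem_epi {X : Type*} {φ : X → EReal} {x : X} {t : ℝ} : (x, t) ∈ epi φ ↔ φ x ≤ t := Iff.rfl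

variable {n : ℕ} {φ : EuclideanSpace ℝ (Fin n) → EReal}

theorem IsGeometricConvex.nonneg_of_mem_epi (hφ : IsGeometricConvex φ)
    {x : EuclideanSpace ℝ (Fin n)} {t : ℝ} (h : (x, t) ∈ epi φ) : 0 ≤ t :=
  EReal.coe_nonneg.1 ((hφ.nonneg x).trans h)

theorem IsGeometricConvex.zero_mem_epi (hφ : IsGeometricConvex φ) {t : ℝ} (ht : 0 ≤ t) :
    ((0 : EuclideanSpace ℝ (Fin n)), t) ∈ epi φ := by
  rw [mem_epi, hφ.map_zero]
  exact EReal.coe_nonneg.2 ht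

theorem IsGeometricConvex.polarTransform_nonneg (hφ : IsGeometricConvex φ)
    (y : EuclideanSpace ℝ (Fin n)) : 0 ≤ polarTransform φ y := by
  unfold polarTransform
  split_ifs with hy hpol
  · exact le_rfl
  · have hn : (0 : ℝ) < ‖y‖ ^ 2 := by positivity
    -- Any pairing above `1` forces `φ` to be nonzero at this point, and makes its term in the
    -- supremum nonnegative.
    have hin : inner ℝ ((2 / ‖y‖ ^ 2) • y) y = (2 : ℝ) := by
      rw [real_inner_smul_left, real_inner_self_eq_norm_sq]
      field_simp
    have hpos : 0 < φ ((2 / ‖y‖ ^ 2) • y) := by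
      refine (hφ.nonneg _).lt_of_ne fun h => ?_
      have := hpol _ h.symm
      rw [hin] at this
      norm_num at this
    refine le_iSup₂_of_le _ hpos ?_
    rw [hin]
    exact EReal.div_nonneg (EReal.coe_nonneg.2 (by norm_num)) hpos.le
  · exact le_top

/-- One family of linear inequalities encodes every case of the definition: `t = 0` gives the polar
of the zero set, `x = 0` with large `t` forces `0 ≤ s`, and `t = φ x` gives the quotients. Points of
value `⊤` only ask for `0 ≤ s`. -/
theorem IsGeometricConvex.mem_epi_polarTransform (hφ : IsGeometricConvex φ)
    (y : EuclideanSpace ℝ (Fin n)) (s : ℝ) :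
    (y, s) ∈ epi (polarTransform φ) ↔
      ∀ x t, (x, t) ∈ epi φ → inner ℝ x y - s * t ≤ 1 := by
  constructor
  · intro h x t hxt
    have hs : 0 ≤ s := EReal.coe_nonneg.1 ((hφ.polarTransform_nonneg y).trans h)
    have ht := hφ.nonneg_of_mem_epi hxt
    have hst := mul_nonneg hs ht
    rw [mem_epi, polarTransform] at h
    split_ifs at h with hy hpol
    · rw [hy, inner_zero_right]
      linarith
    · rcases (hφ.nonneg x).eq_or_lt with h0 | h0
      · linarith [hpol x h0.symm]
      · have hx := (iSup₂_le_iff.1 h) x h0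
        lift φ x to ℝ using ⟨(hxt.trans_lt (EReal.coe_lt_top t)).ne, (bot_le.trans_lt h0).ne'⟩
          with r hr
        rw [mem_epi, ← hr, EReal.coe_le_coe_iff] at hxt
        rw [← EReal.coe_div, EReal.coe_le_coe_iff, div_le_iff₀ (EReal.coe_pos.1 h0)] at hx
        nlinarith
    · exact absurd h (by simp)
  · intro h
    have hs : 0 ≤ s := by
      by_contra! hs
      have h1 := h 0 (-2 / s) (hφ.zero_mem_epi (div_nonneg_of_nonpos (by norm_num) hs.le))
      rw [inner_zero_left, mul_div_cancel₀ _ hs.ne] at h1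
      norm_num at h1
    rw [mem_epi, polarTransform]
    split_ifs with hy hpol
    · exact EReal.coe_nonneg.2 hs
    · refine iSup₂_le fun x (hx : 0 < φ x) => ?_
      by_cases htop : φ x = ⊤
      · rw [htop, EReal.div_top]
        exact EReal.coe_nonneg.2 hs
      · lift φ x to ℝ using ⟨htop, (bot_le.trans_lt hx).ne'⟩ with r hr
        rw [← EReal.coe_div, EReal.coe_le_coe_iff, div_le_iff₀ (EReal.coe_pos.1 hx)]
        linarith [h x r hr.ge]
    · refine absurd (fun x (hx : φ x = 0) => ?_) hpol
      simpa using h x 0 (by rw [mem_epi, hx, EReal.coe_zero])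

/-- The identification of the `ℓ²`-product with the product. -/
noncomputable def ofLpHomeomorph (E : Type*) [NormedAddCommGroup E] [NormedSpace ℝ E] :
    WithLp 2 (E × ℝ) ≃ₜ E × ℝ :=
  (WithLp.prodContinuousLinearEquiv 2 ℝ E ℝ).toHomeomorph

/-- The identification of the `ℓ²`-product with the product, followed by the reflection of the
second coordinate. -/
noncomputable def ofLpReflection (E : Type*) [NormedAddCommGroup E] [NormedSpace ℝ E] :
    WithLp 2 (E × ℝ) ≃ₜ E × ℝ :=
  (ofLpHomeomorph E).trans ((Homeomorph.refl E).prodCongr (Homeomorph.neg ℝ))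

/-- The reflection turns `inner ℝ x y - s * t` into the `ℓ²` inner product of `(x, t)` with `(y,
-s)`. -/
theorem IsGeometricConvex.preimage_epi_polarTransform (hφ : IsGeometricConvex φ) :
    ofLpReflection _ ⁻¹' epi (polarTransform φ) = innerPolar (ofLpHomeomorph _ ⁻¹' epi φ) := by
  ext q
  have hq : ofLpReflection _ q = (q.fst, -q.snd) := rfl
  rw [Set.mem_preimage, hq, hφ.mem_epi_polarTransform]
  constructor
  · intro h p hp
    have := h p.fst p.snd hp
    rw [WithLp.prod_inner_apply]
    simpa [mul_comm] using this
  · intro h x t hxt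
    have := h (WithLp.toLp 2 (x, t)) hxt
    rw [WithLp.prod_inner_apply] at this
    simpa [mul_comm] using this

theorem tauTendsto_polarTransform_iff {φs : ℕ → EuclideanSpace ℝ (Fin n) → EReal}
    (hφs : ∀ m, IsGeometricConvex (φs m)) (hφ : IsGeometricConvex φ) :
    TauTendsto (fun m => polarTransform (φs m)) (polarTransform φ) ↔ TauTendsto φs φ := by
  have hc : ∀ {ψ : EuclideanSpace ℝ (Fin n) → EReal}, IsGeometricConvex ψ →
      Convex ℝ (ofLpHomeomorph _ ⁻¹' epi ψ) := fun hψ =>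
    hψ.convex_epi.linear_preimage
      (WithLp.prodContinuousLinearEquiv 2 ℝ (EuclideanSpace ℝ (Fin n)) ℝ).toLinearMap
  have hcl : ∀ {ψ : EuclideanSpace ℝ (Fin n) → EReal}, IsGeometricConvex ψ →
      IsClosed (ofLpHomeomorph _ ⁻¹' epi ψ) := fun hψ =>
    hψ.isClosed_epi.preimage (ofLpHomeomorph _).continuous
  have h0 : ∀ {ψ : EuclideanSpace ℝ (Fin n) → EReal}, IsGeometricConvex ψ →
      0 ∈ ofLpHomeomorph _ ⁻¹' epi ψ := fun hψ => hψ.zero_mem_epi le_rfl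
  unfold TauTendsto
  rw [← setTauTendsto_preimage_iff (ofLpReflection _), hφ.preimage_epi_polarTransform]
  simp only [(hφs _).preimage_epi_polarTransform]
  rw [setTauTendsto_innerPolar_iff (fun m => hc (hφs m)) (fun m => hcl (hφs m))
    (fun m => h0 (hφs m)) (hc hφ) (hcl hφ) (h0 hφ), setTauTendsto_preimage_iff]

/-! ### The gauge transform -/

theorem gaugeTransform_nonneg (φ : EuclideanSpace ℝ (Fin n) → EReal)
    (x : EuclideanSpace ℝ (Fin n)) : 0 ≤ gaugeTransform φ x := by
  refine le_sInf ?_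
  rintro _ ⟨r, hr, rfl⟩
  exact EReal.coe_nonneg.2 hr.1.le

/-- Convexity allows scaling by `r / s ≤ 1` towards the origin, so the radii competing in the gauge
infimum form an up-closed set. -/
theorem IsGeometricConvex.mem_epi_inv_smul_of_le (hφ : IsGeometricConvex φ)
    {x : EuclideanSpace ℝ (Fin n)} {r s : ℝ} (hr : 0 < r) (hrs : r ≤ s)
    (h : (r⁻¹ • x, r⁻¹) ∈ epi φ) : (s⁻¹ • x, s⁻¹) ∈ epi φ := by
  have hs : 0 < s := hr.trans_le hrs
  have := hφ.convex_epi.smul_mem_of_zero_mem (hφ.zero_mem_epi le_rfl) h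
    (t := r / s) ⟨by positivity, (div_le_one hs).2 hrs⟩
  rw [Prod.smul_mk, smul_smul, smul_eq_mul] at this
  have e : r / s * r⁻¹ = s⁻¹ := by field_simp
  rwa [e] at this

/-- Every `s > r` is admissible, and closedness of the epigraph lets `s` decrease to `r`; inversion
is continuous there because `0 < r`. -/
theorem IsGeometricConvex.mem_epi_gaugeTransform (hφ : IsGeometricConvex φ)
    (x : EuclideanSpace ℝ (Fin n)) {r : ℝ} (hr : 0 < r) :
    (x, r) ∈ epi (gaugeTransform φ) ↔ (r⁻¹ • x, r⁻¹) ∈ epi φ := by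
  constructor
  · intro h
    have hgt : ∀ s ∈ Set.Ioi r, (s⁻¹ • x, s⁻¹) ∈ epi φ := by
      intro s hs
      have hlt : gaugeTransform φ x < s := lt_of_le_of_lt h (EReal.coe_lt_coe_iff.2 hs)
      obtain ⟨_, ⟨q, hq, rfl⟩, hqs⟩ := sInf_lt_iff.1 hlt
      exact hφ.mem_epi_inv_smul_of_le hq.1 (EReal.coe_lt_coe_iff.1 hqs).le hq.2
    have hinv : Tendsto (fun s : ℝ => s⁻¹) (𝓝[>] r) (𝓝 r⁻¹) :=
      (tendsto_inv₀ hr.ne').mono_left nhdsWithin_le_nhds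
    exact hφ.isClosed_epi.mem_of_tendsto ((hinv.smul_const x).prodMk_nhds hinv)
      (eventually_mem_nhdsWithin.mono hgt)
  · intro h
    rw [mem_epi, gaugeTransform]
    exact sInf_le ⟨r, ⟨hr, h⟩, rfl⟩

/-- If the epigraphs of nonnegative functions correspond to each other, over positive heights, by
the involution `(x, r) ↦ (x / r, 1 / r)`, then epi-convergence is preserved. -/
theorem TauTendsto.of_inversion {E : Type*} [NormedAddCommGroup E] [NormedSpace ℝ E]
    {φs ψs : ℕ → E → EReal} {φ ψ : E → EReal} (hψs : ∀ m x, 0 ≤ ψs m x) (hψ : ∀ x, 0 ≤ ψ x)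
    (hs : ∀ m x (r : ℝ), 0 < r → ((x, r) ∈ epi (ψs m) ↔ (r⁻¹ • x, r⁻¹) ∈ epi (φs m)))
    (h : ∀ x (r : ℝ), 0 < r → ((x, r) ∈ epi ψ ↔ (r⁻¹ • x, r⁻¹) ∈ epi φ))
    (hlim : TauTendsto φs φ) : TauTendsto ψs ψ := by
  have hcont : ∀ {q : ℕ → E × ℝ} {x : E} {r : ℝ}, 0 < r → Tendsto q atTop (𝓝 (x, r)) →
      Tendsto (fun j => ((q j).2⁻¹ • (q j).1, (q j).2⁻¹)) atTop (𝓝 (r⁻¹ • x, r⁻¹)) := by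
    intro q x r hr hq
    have h2 := (hq.snd_nhds).inv₀ hr.ne'
    exact (h2.smul hq.fst_nhds).prodMk_nhds h2
  constructor
  · have hpos : ∀ (x : E) (r : ℝ), 0 < r → (x, r) ∈ limsupSet (fun m => epi (ψs m)) →
        (x, r) ∈ epi ψ := by
      rintro x r hr ⟨m, hm, q, hq, hqx⟩
      -- Early terms may have height `0`, where the inversion is not available, so a tail is taken.
      obtain ⟨N, hN⟩ := eventually_atTop.1 (hqx.snd_nhds.eventually (lt_mem_nhds hr))
      refine (h x r hr).2 (hlim.1 ⟨fun j => m (j + N), fun a b hab => hm (by omega), _, fun j => ?_,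
        (tendsto_add_atTop_iff_nat N).2 (hcont hr hqx)⟩)
      exact (hs _ _ _ (hN (j + N) (by omega))).1 (hq _)
    rintro ⟨x, r⟩ ⟨m, hm, q, hq, hqx⟩
    have hr : 0 ≤ r := ge_of_tendsto' hqx.snd_nhds fun j =>
      EReal.coe_nonneg.1 ((hψs _ _).trans (hq j))
    -- Since `r` may be `0`, the sequence is lifted by `s - r`, staying in the epigraphs, to reach a
    -- positive limiting height `s`.
    refine EReal.le_of_forall_lt_iff_le.1 fun s hrs => ?_
    replace hrs : r < s := EReal.coe_lt_coe_iff.1 hrs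
    refine hpos x s (hr.trans_lt hrs)
      ⟨m, hm, fun j => ((q j).1, (q j).2 + (s - r)), fun j => ?_, ?_⟩
    · exact (hq j).trans (EReal.coe_le_coe_iff.2 (by linarith))
    · have := hqx.fst_nhds.prodMk_nhds (hqx.snd_nhds.add_const (s - r))
      simpa using this
  · have hpos : ∀ (x : E) (r : ℝ), 0 < r → (x, r) ∈ epi ψ →
        (x, r) ∈ liminfSet (fun m => epi (ψs m)) := by
      intro x r hr hx
      obtain ⟨q, hq, hqx⟩ := hlim.2 ((h x r hr).1 hx)
      have hlim' := hcont (inv_pos.2 hr) hqx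
      rw [inv_inv, smul_smul, mul_inv_cancel₀ hr.ne', one_smul] at hlim'
      refine ⟨_, ?_, hlim'⟩
      filter_upwards [hq, hqx.snd_nhds.eventually (lt_mem_nhds (inv_pos.2 hr))] with m hm hm0
      rw [hs _ _ _ (inv_pos.2 hm0), inv_inv, smul_smul, mul_inv_cancel₀ hm0.ne', one_smul]
      exact hm
    rintro ⟨x, r⟩ hx
    have hr : 0 ≤ r := EReal.coe_nonneg.1 ((hψ x).trans hx)
    have hid : Tendsto (fun s : ℝ => (x, s)) (𝓝[>] r) (𝓝 (x, r)) :=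
      (tendsto_const_nhds.prodMk_nhds tendsto_id).mono_left nhdsWithin_le_nhds
    -- The points `(x, s)` with `s > r` lie in the lower limit, which is closed, so the case `r = 0`
    -- follows.
    refine (isClosed_liminfSet _).mem_of_tendsto hid ?_
    filter_upwards [eventually_mem_nhdsWithin] with s hs'
    exact hpos x s (hr.trans_lt hs') (le_trans hx (EReal.coe_le_coe_iff.2 (le_of_lt hs')))

theorem tauTendsto_gaugeTransform_iff {φs : ℕ → EuclideanSpace ℝ (Fin n) → EReal}
    (hφs : ∀ m, IsGeometricConvex (φs m)) (hφ : IsGeometricConvex φ) :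
    TauTendsto (fun m => gaugeTransform (φs m)) (gaugeTransform φ) ↔ TauTendsto φs φ := by
  have hinv : ∀ {ψ : EuclideanSpace ℝ (Fin n) → EReal}, IsGeometricConvex ψ →
      ∀ x (r : ℝ), 0 < r → ((x, r) ∈ epi ψ ↔ (r⁻¹ • x, r⁻¹) ∈ epi (gaugeTransform ψ)) := by
    intro ψ hψ x r hr
    rw [hψ.mem_epi_gaugeTransform _ (inv_pos.2 hr), inv_inv, smul_smul, mul_inv_cancel₀ hr.ne',
      one_smul]
  constructor
  · exact TauTendsto.of_inversion (fun m => (hφs m).nonneg) hφ.nonneg (fun m => hinv (hφs m))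
      (hinv hφ)
  · exact TauTendsto.of_inversion (fun m => gaugeTransform_nonneg _) (gaugeTransform_nonneg φ)
      (fun m x r => (hφs m).mem_epi_gaugeTransform x) fun x r => hφ.mem_epi_gaugeTransform x

end GeomConvex

theorem mainTheorem4 {n : ℕ} (φs : ℕ → EuclideanSpace ℝ (Fin n) → EReal)
    (φ : EuclideanSpace ℝ (Fin n) → EReal)
    (hφs : ∀ m, GeomConvex.IsGeometricConvex (φs m)) (hφ : GeomConvex.IsGeometricConvex φ) :
    (GeomConvex.TauTendsto φs φ ↔
      GeomConvex.TauTendsto (fun m => GeomConvex.polarTransform (φs m))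
        (GeomConvex.polarTransform φ)) ∧
    (GeomConvex.TauTendsto φs φ ↔
      GeomConvex.TauTendsto (fun m => GeomConvex.gaugeTransform (φs m))
        (GeomConvex.gaugeTransform φ)) := by
  exact ⟨(GeomConvex.tauTendsto_polarTransform_iff hφs hφ).symm,
    (GeomConvex.tauTendsto_gaugeTransform_iff hφs hφ).symm⟩
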